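/- Let $k$ be a natural number, let $\mathbb{F}_k$ be the free group on $k$ generators $w_1,\dots,w_k$, and let $\widehat{\mathbb{F}}_k$ be its profinite completion, with Haar probability measure $\mu$. Let $N_0=\mathrm{Clop}(\widehat{\mathbb{F}}_k)$ be the Boolean algebra of clopen subsets of $\widehat{\mathbb{F}}_k$, measured by $\mu$, and let $H=\mathrm{Aut}(N_0)$ be the group of automorphisms of the Boolean algebra $N_0$ that preserve $\mu$, with the topology of pointwise convergence ($N_0$ being discrete). Let $\bar p=(p_1,\dots,p_k)\in H^k$ be the tuple through which $w_1,\dots,w_k$ act on $N_0$ by left multiplication, $p_i(a)=w_ia=\{w_ix:x\in a\}$. Let $$E_k=\bigcap_{a\in N_0\setminus\{\emptyset,\widehat{\mathbb{F}}_k\}}\ \bigcup_{1\le i\le k}\{\bar h\in H^k: h_i(a)\neq a\}$$ be the set of $k$-tuples in $H^k$ with no non-trivial common fixed point in $N_0$. Then $E_k$ is closed in $H^k$, in particular a Polish space, and the action $\mathbb{F}_k\curvearrowright N_0$ is generic in $E_k$: the diagonal conjugacy class $H\cdot\bar p=\{(hp_1h^{-1},\dots,hp_kh^{-1}):h\in H\}$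 is contained in $E_k$ and is comeager in $E_k$ for the subspace topology. -/

import Mathlib

open MeasureTheory TopologicalSpace

namespace ProfiniteAction

/-- The profinite completion of the free group `FreeGroup (Fin k)` of rank `k`. -/
abbrev FreeCompletion (k : ℕ) : Type :=
  ProfiniteGrp.ProfiniteCompletion.completion (GrpCat.of (FreeGroup (Fin k)))

/-- The canonical homomorphism from the free group to its profinite completion. -/
def toCompletion (k : ℕ) : FreeGroup (Fin k) →* FreeCompletion k :=
  (ProfiniteGrp.ProfiniteCompletion.eta (GrpCat.of (FreeGroup (Fin k)))).hom

instance instMeasurableSpaceFreeCompletion (k : ℕ) : MeasurableSpace (FreeCompletion k) :=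
  borel _

instance instBorelSpaceFreeCompletion (k : ℕ) : BorelSpace (FreeCompletion k) := ⟨rfl⟩

/-- The Haar probability measure of the profinite completion (total mass one). -/
noncomputable def haarProb (k : ℕ) : Measure (FreeCompletion k) :=
  Measure.haarMeasure (⊤ : PositiveCompacts (FreeCompletion k))

instance instIsMulLeftInvariantHaarProb (k : ℕ) : (haarProb k).IsMulLeftInvariant :=
  Measure.isMulLeftInvariant_haarMeasure _

/-- The Boolean algebra of clopen subsets of the profinite completion. -/
abbrev ClopAlg (k : ℕ) : Type := Clopens (FreeCompletion k)

/-- The automorphism group of the measured Boolean algebra of clopen sets: all automorphisms of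
the Boolean algebra (that is, of the underlying order) which preserve the Haar measure. -/
def measuredAut (k : ℕ) : Subgroup (ClopAlg k ≃o ClopAlg k) where
  carrier := {h | ∀ a : ClopAlg k,
    haarProb k (h a : Set (FreeCompletion k)) = haarProb k (a : Set (FreeCompletion k))}
  mul_mem' {g h} hg hh a := (hg (h a)).trans (hh a)
  one_mem' _ := rfl
  inv_mem' {h} hh a := by
    have e := hh (h⁻¹ a)
    rw [← RelIso.mul_apply, mul_inv_cancel] at e
    exact e.symm

/-- The topology of the automorphism group of a classical structure: pointwise convergence, the
structure being discrete. -/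
instance instTopologicalSpaceMeasuredAut (k : ℕ) : TopologicalSpace (measuredAut k) :=
  TopologicalSpace.induced
    (fun (h : measuredAut k) (a : ClopAlg k) => (h : ClopAlg k ≃o ClopAlg k) a)
    (@Pi.topologicalSpace (ClopAlg k) (fun _ => ClopAlg k) (fun _ => ⊥))

/-- The translate `g a = {g x : x ∈ a}` of a clopen set. -/
def leftMulClop {k : ℕ} (g : FreeCompletion k) (a : ClopAlg k) : ClopAlg k :=
  ⟨(fun x => g * x) '' (a : Set (FreeCompletion k)),
    ⟨(Homeomorph.mulLeft g).isClosed_image.2 a.isClopen.1,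
      (Homeomorph.mulLeft g).isOpen_image.2 a.isClopen.2⟩⟩

theorem mem_leftMulClop {k : ℕ} (g x : FreeCompletion k) (a : ClopAlg k) :
    x ∈ leftMulClop g a ↔ g⁻¹ * x ∈ a := by
  constructor
  · rintro ⟨y, hy, rfl⟩
    simpa using! hy
  · intro h
    exact ⟨g⁻¹ * x, h, by simp⟩

theorem leftMulClop_leftMulClop {k : ℕ} (g h : FreeCompletion k) (a : ClopAlg k) :
    leftMulClop g (leftMulClop h a) = leftMulClop (g * h) a := by
  apply SetLike.ext
  intro x
  simp [mem_leftMulClop, mul_assoc]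

theorem leftMulClop_one {k : ℕ} (a : ClopAlg k) : leftMulClop 1 a = a := by
  apply SetLike.ext
  intro x
  simp [mem_leftMulClop]

/-- Translation by an element of the profinite completion, as an automorphism of the Boolean
algebra of clopen sets. -/
def leftMulIso {k : ℕ} (g : FreeCompletion k) : ClopAlg k ≃o ClopAlg k where
  toFun := leftMulClop g
  invFun := leftMulClop g⁻¹
  left_inv a := by rw [leftMulClop_leftMulClop, inv_mul_cancel, leftMulClop_one]
  right_inv a := by rw [leftMulClop_leftMulClop, mul_inv_cancel, leftMulClop_one]
  map_rel_iff' {a b} := by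
    constructor
    · intro h x hx
      have : g * x ∈ leftMulClop g a := ⟨x, hx, rfl⟩
      simpa [mem_leftMulClop] using h this
    · rintro h _ ⟨x, hx, rfl⟩
      exact ⟨x, h hx, rfl⟩

theorem leftMulIso_mem {k : ℕ} (g : FreeCompletion k) : leftMulIso g ∈ measuredAut k := by
  intro a
  have e : ((leftMulIso g a : ClopAlg k) : Set (FreeCompletion k)) =
      (fun x => g⁻¹ * x) ⁻¹' (a : Set (FreeCompletion k)) :=
    Set.ext fun x => mem_leftMulClop g x a
  rw [e, measure_preimage_mul]

/-- The action of the free group on the measured Boolean algebra of clopen subsets of its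
profinite completion, induced by left multiplication. -/
def freeAction (k : ℕ) : FreeGroup (Fin k) →* measuredAut k where
  toFun w := ⟨leftMulIso (toCompletion k w), leftMulIso_mem _⟩
  map_one' := by
    apply Subtype.ext
    apply RelIso.ext
    intro a
    change leftMulClop (toCompletion k 1) a = a
    rw [map_one, leftMulClop_one]
  map_mul' v w := by
    apply Subtype.ext
    apply RelIso.ext
    intro a
    change leftMulClop (toCompletion k (v * w)) a =
      leftMulClop (toCompletion k v) (leftMulClop (toCompletion k w) a)
    rw [map_mul, leftMulClop_leftMulClop]

/-- The set of `k`-tuples of automorphisms of the measured algebra of clopen sets without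
non-trivial common fixed points. -/
def fixedPointFree (k : ℕ) : Set (Fin k → measuredAut k) :=
  ⋂ a ∈ {a : ClopAlg k | a ≠ ⊥ ∧ a ≠ ⊤}, ⋃ i : Fin k,
    {h : Fin k → measuredAut k | (h i : ClopAlg k ≃o ClopAlg k) a ≠ a}

/-- The diagonal conjugacy class of a tuple of elements of a group. -/
def diagConjClass {H : Type*} [Group H] {k : ℕ} (p : Fin k → H) : Set (Fin k → H) :=
  {q | ∃ h : H, ∀ i, q i = h * p i * h⁻¹}

/-- An action `ρ` of the free group by elements of `H` is generic in `E ⊆ H ^ k` if the diagonal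
conjugacy class of the tuple given by the free generators is a comeager subset of `E`, for the
subspace topology of `E`. -/
def IsGenericIn {H : Type*} [Group H] [TopologicalSpace H] {k : ℕ}
    (ρ : FreeGroup (Fin k) →* H) (E : Set (Fin k → H)) : Prop :=
  diagConjClass (fun i => ρ (FreeGroup.of i)) ⊆ E ∧
    ((↑) : E → Fin k → H) ⁻¹' diagConjClass (fun i => ρ (FreeGroup.of i)) ∈ residual E

end ProfiniteAction

namespace ProfiniteAction

/-! Write F for the free group, E for `fixedPointFree k` and C for the conjugacy class of the
canonical tuple. Clopen sets are the sets `cyl N B` pulled back from finite quotients F/N, and they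
are determined by their traces on the dense image of F. So there are countably many of them, and
every statement about them becomes finite combinatorics.

Density of C in E (`exists_diagConjClass_eqOn`): on finitely many clopen sets of level M, a tuple h
in E acts like permutations σ of a finer quotient F/N, because h preserves measure and measure
counts cosets. Absence of common fixed points says that no nontrivial M-saturated set is
σ-invariant. Hence σ can be corrected inside the fibres of F/N → F/M so as to become transitive
(`exists_transitive_mul`). A transitive action on F/N is in turn induced by a conjugate of the
canonical action: both it and translation on F/N are factors of one finite quotient of F, with
fibres of the same size, and a piecewise translation matches the fibres
(`exists_diagConjClass_cyl`).

Genericity: `finiteOrbitSet a` and `wanderingSet N` are countably many open sets containing C, hence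
dense open in E. A tuple h in E lying in all of them belongs to C (`mem_diagConjClass`). In terms of
Stone duality, h acts on the space of points, and `visitSet h a` is the set of words that send the
point 1 into a. Finite orbits make visit sets traces of clopen sets; absence of fixed points makes
the orbit of 1 dense, so that a is recovered from its visit set; wandering sets make every clopen
trace occur. The resulting isomorphism is equivariant, and it preserves measure because the
invariant probability is unique. -/

/-! ### Traces, finite quotients and levels of clopen sets -/

/-- The trace on the free group of a clopen subset of its profinite completion. -/
def trace {k : ℕ} (a : ClopAlg k) : Set (FreeGroup (Fin k)) := {w | toCompletion k w ∈ a}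

theorem mem_trace {k : ℕ} {a : ClopAlg k} {w : FreeGroup (Fin k)} :
    w ∈ trace a ↔ toCompletion k w ∈ a := Iff.rfl

theorem denseRange_toCompletion (k : ℕ) : DenseRange (toCompletion k) :=
  ProfiniteGrp.ProfiniteCompletion.denseRange _

/-- The difference of two clopen sets is open, so if nonempty it meets the dense image of the free
group. -/
theorem trace_subset_trace {k : ℕ} {a b : ClopAlg k} : trace a ⊆ trace b ↔ a ≤ b := by
  refine ⟨fun h => ?_, fun h w hw => h hw⟩
  intro x hx
  by_contra hb
  obtain ⟨w, hw⟩ := (denseRange_toCompletion k).exists_mem_open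
    (a.isClopen.2.inter b.isClopen.compl.2) ⟨x, hx, hb⟩
  exact hw.2 (h hw.1)

theorem trace_injective {k : ℕ} : Function.Injective (trace (k := k)) := fun _ _ h =>
  le_antisymm (trace_subset_trace.1 h.le) (trace_subset_trace.1 h.ge)

/-- The projection of the profinite completion to a finite quotient. -/
def proj {k : ℕ} (N : FiniteIndexNormalSubgroup (FreeGroup (Fin k))) :
    FreeCompletion k →* FreeGroup (Fin k) ⧸ N.toSubgroup where
  toFun x := x.1 N
  map_one' := rfl
  map_mul' _ _ := rfl

theorem proj_toCompletion {k : ℕ} (N : FiniteIndexNormalSubgroup (FreeGroup (Fin k)))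
    (w : FreeGroup (Fin k)) : proj N (toCompletion k w) = (w : FreeGroup (Fin k) ⧸ N.toSubgroup) :=
  rfl

theorem isClopen_proj_preimage {k : ℕ} (N : FiniteIndexNormalSubgroup (FreeGroup (Fin k)))
    (B : Set (FreeGroup (Fin k) ⧸ N.toSubgroup)) : IsClopen (proj N ⁻¹' B) := by
  let D := (ProfiniteGrp.ProfiniteCompletion.diagram (GrpCat.of (FreeGroup (Fin k)))).obj N
  have hc : Continuous (fun x : FreeCompletion k => (x.1 N : D)) :=
    (continuous_apply N).comp continuous_subtype_val
  have : DiscreteTopology D := ⟨rfl⟩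
  exact (isClopen_discrete (X := D) B).preimage hc

/-- The clopen set of the points whose image in a finite quotient lies in a given set. -/
def cyl {k : ℕ} (N : FiniteIndexNormalSubgroup (FreeGroup (Fin k)))
    (B : Set (FreeGroup (Fin k) ⧸ N.toSubgroup)) : ClopAlg k :=
  ⟨proj N ⁻¹' B, isClopen_proj_preimage N B⟩

variable {k : ℕ}

/-- The quotient of the free group by a finite-index normal subgroup. -/
abbrev FinQuot (N : FiniteIndexNormalSubgroup (FreeGroup (Fin k))) : Type :=
  FreeGroup (Fin k) ⧸ N.toSubgroup

theorem mem_trace_cyl {N : FiniteIndexNormalSubgroup (FreeGroup (Fin k))} {B : Set (FinQuot N)}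
    {w : FreeGroup (Fin k)} : w ∈ trace (cyl N B) ↔ (w : FinQuot N) ∈ B := Iff.rfl

theorem proj_surjective (N : FiniteIndexNormalSubgroup (FreeGroup (Fin k))) :
    Function.Surjective (proj N) := by
  intro q
  obtain ⟨w, rfl⟩ := QuotientGroup.mk_surjective q
  exact ⟨toCompletion k w, rfl⟩

theorem cyl_injective (N : FiniteIndexNormalSubgroup (FreeGroup (Fin k))) :
    Function.Injective (cyl N) := by
  intro B C h
  apply (proj_surjective N).preimage_injective
  exact congrArg (fun a : ClopAlg k => (a : Set (FreeCompletion k))) h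

/-- A clopen set has level `N` if its trace is a union of cosets of `N`. -/
def IsLevel (N : FiniteIndexNormalSubgroup (FreeGroup (Fin k))) (a : ClopAlg k) : Prop :=
  ∀ w, ∀ n ∈ N, w ∈ trace a → w * n ∈ trace a

theorem IsLevel.mono {M N : FiniteIndexNormalSubgroup (FreeGroup (Fin k))} {a : ClopAlg k}
    (h : IsLevel N a) (hMN : M ≤ N) : IsLevel M a := fun w n hn => h w n (hMN hn)

theorem exists_trace_cyl_eq {N : FiniteIndexNormalSubgroup (FreeGroup (Fin k))}
    {S : Set (FreeGroup (Fin k))} (hS : ∀ w, ∀ n ∈ N, w ∈ S → w * n ∈ S) :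
    ∃ B : Set (FinQuot N), trace (cyl N B) = S := by
  refine ⟨(fun w : FreeGroup (Fin k) => (w : FinQuot N)) '' S, ?_⟩
  ext w
  rw [mem_trace_cyl]
  refine ⟨?_, fun hw => ⟨w, hw, rfl⟩⟩
  rintro ⟨v, hv, hvw⟩
  have := hS v (v⁻¹ * w) (QuotientGroup.eq.1 hvw) hv
  rwa [mul_inv_cancel_left] at this

theorem IsLevel.eq_cyl {N : FiniteIndexNormalSubgroup (FreeGroup (Fin k))} {a : ClopAlg k}
    (h : IsLevel N a) : ∃ B : Set (FinQuot N), a = cyl N B := by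
  obtain ⟨B, hB⟩ := exists_trace_cyl_eq h
  exact ⟨B, trace_injective hB.symm⟩

/-- A compact open set is stable under right multiplication by a neighbourhood of 1, which contains
an open normal subgroup; its preimage in the free group is the level. -/
theorem exists_isLevel (a : ClopAlg k) :
    ∃ N : FiniteIndexNormalSubgroup (FreeGroup (Fin k)), IsLevel N a := by
  obtain ⟨T, hT, haT⟩ := IsTopologicalGroup.exist_mul_closure_nhds a.isClopen
  obtain ⟨O, hOT, hO, h1⟩ := mem_nhds_iff.1 hT
  obtain ⟨U, hU⟩ := ProfiniteGrp.exist_openNormalSubgroup_sub_open_nhds_of_one hO h1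
  refine ⟨U.toFiniteIndexNormalSubgroup.comap (toCompletion k), fun w n hn hw => ?_⟩
  rw [mem_trace, map_mul]
  exact haT (Set.mul_mem_mul hw (hOT (hU hn)))

theorem exists_isLevel_finset (s : Finset (ClopAlg k)) :
    ∃ N : FiniteIndexNormalSubgroup (FreeGroup (Fin k)), ∀ a ∈ s, IsLevel N a := by
  classical
  induction s using Finset.induction_on with
  | empty => exact ⟨(exists_isLevel (⊤ : ClopAlg k)).choose, by simp⟩
  | insert a s _ ih =>
    obtain ⟨N, hN⟩ := ih
    obtain ⟨M, hM⟩ := exists_isLevel a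
    refine ⟨M ⊓ N, fun b hb => ?_⟩
    rcases Finset.mem_insert.1 hb with rfl | hb
    · exact hM.mono inf_le_left
    · exact (hN b hb).mono inf_le_right

theorem mem_trace_freeAction {v w : FreeGroup (Fin k)} {a : ClopAlg k} :
    v ∈ trace ((freeAction k w : ClopAlg k ≃o ClopAlg k) a) ↔ w⁻¹ * v ∈ trace a := by
  rw [mem_trace, mem_trace, map_mul, map_inv]
  exact mem_leftMulClop _ _ _

theorem freeAction_cyl (N : FiniteIndexNormalSubgroup (FreeGroup (Fin k))) (w : FreeGroup (Fin k))
    (B : Set (FinQuot N)) :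
    (freeAction k w : ClopAlg k ≃o ClopAlg k) (cyl N B) =
      cyl N ((fun q => (w : FinQuot N) * q) '' B) := by
  apply trace_injective
  ext v
  rw [mem_trace_freeAction, mem_trace_cyl, mem_trace_cyl, Set.image_mul_left]
  rfl

theorem cyl_empty (N : FiniteIndexNormalSubgroup (FreeGroup (Fin k))) : cyl N ∅ = ⊥ := rfl

theorem cyl_univ (N : FiniteIndexNormalSubgroup (FreeGroup (Fin k))) : cyl N Set.univ = ⊤ := rfl

theorem cyl_union (N : FiniteIndexNormalSubgroup (FreeGroup (Fin k))) (B C : Set (FinQuot N)) :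
    cyl N (B ∪ C) = cyl N B ⊔ cyl N C := rfl

theorem cyl_inter (N : FiniteIndexNormalSubgroup (FreeGroup (Fin k))) (B C : Set (FinQuot N)) :
    cyl N (B ∩ C) = cyl N B ⊓ cyl N C := rfl

instance finite_finQuot (N : FiniteIndexNormalSubgroup (FreeGroup (Fin k))) :
    Finite (FinQuot N) := Subgroup.finite_quotient_of_finiteIndex

/-! ### Uniqueness of the invariant probability -/

open scoped ENNReal in
/-- A translation invariant finitely additive probability on the clopen sets is given by
counting cosets. -/
theorem invariant_content_cyl (m : ClopAlg k → ℝ≥0∞) (hbot : m ⊥ = 0) (htop : m ⊤ = 1)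
    (hsup : ∀ a b, Disjoint a b → m (a ⊔ b) = m a + m b)
    (hinv : ∀ w a, m ((freeAction k w : ClopAlg k ≃o ClopAlg k) a) = m a)
    (N : FiniteIndexNormalSubgroup (FreeGroup (Fin k))) (B : Set (FinQuot N)) :
    m (cyl N B) = B.ncard * (Nat.card (FinQuot N) : ℝ≥0∞)⁻¹ := by
  have hsingle : ∀ q : FinQuot N, m (cyl N {q}) = m (cyl N {1}) := by
    intro q
    obtain ⟨w, rfl⟩ := QuotientGroup.mk_surjective q
    rw [← hinv w (cyl N {1}), freeAction_cyl]
    simp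
  have key : ∀ B : Set (FinQuot N), m (cyl N B) = B.ncard * m (cyl N {1}) := by
    intro B
    induction B, Set.toFinite B using Set.Finite.induction_on with
    | empty => simp [cyl_empty, hbot]
    | @insert q B hq hB ih =>
      rw [Set.insert_eq, cyl_union, hsup, ih, hsingle, ← Set.insert_eq,
        Set.ncard_insert_of_notMem hq hB]
      · push_cast
        ring
      · rw [disjoint_iff, ← cyl_inter, Set.singleton_inter_eq_empty.2 hq, cyl_empty]
  have h1 := key Set.univ
  rw [cyl_univ, htop, Set.ncard_univ] at h1
  rw [key B, ENNReal.eq_inv_of_mul_eq_one_left (a := m (cyl N {1})) (by rw [mul_comm]; exact h1.symm)]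

theorem measurableSet_clop (a : ClopAlg k) : MeasurableSet (a : Set (FreeCompletion k)) :=
  a.isClopen.2.measurableSet

theorem haarProb_cyl (N : FiniteIndexNormalSubgroup (FreeGroup (Fin k))) (B : Set (FinQuot N)) :
    haarProb k (cyl N B : Set (FreeCompletion k)) =
      B.ncard * (Nat.card (FinQuot N) : ENNReal)⁻¹ := by
  refine invariant_content_cyl (fun a => haarProb k (a : Set (FreeCompletion k))) ?_ ?_ ?_ ?_ N B
  · simp
  · exact Measure.haarMeasure_self
  · intro a b hab
    rw [Clopens.coe_sup, measure_union _ (measurableSet_clop b)]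
    rw [Set.disjoint_iff_inter_eq_empty]
    exact congrArg (fun a : ClopAlg k => (a : Set (FreeCompletion k))) (disjoint_iff.1 hab)
  · intro w a
    exact (freeAction k w).2 a

theorem ncard_eq_of_haarProb_eq {N : FiniteIndexNormalSubgroup (FreeGroup (Fin k))}
    {B C : Set (FinQuot N)}
    (h : haarProb k (cyl N B : Set (FreeCompletion k)) = haarProb k (cyl N C)) :
    B.ncard = C.ncard := by
  rw [haarProb_cyl, haarProb_cyl, ENNReal.mul_left_inj] at h
  · exact_mod_cast h
  · simp
  · simpa using Nat.card_pos.ne'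

/-! ### Piecewise translations -/

/-- The piecewise translation of the profinite completion which realizes a permutation of a finite
quotient. -/
noncomputable def pieceMap (N : FiniteIndexNormalSubgroup (FreeGroup (Fin k)))
    (τ : Equiv.Perm (FinQuot N)) (x : FreeCompletion k) : FreeCompletion k :=
  toCompletion k ((τ (proj N x)).out * (proj N x).out⁻¹) * x

theorem proj_pieceMap (N : FiniteIndexNormalSubgroup (FreeGroup (Fin k)))
    (τ : Equiv.Perm (FinQuot N)) (x : FreeCompletion k) :
    proj N (pieceMap N τ x) = τ (proj N x) := by
  rw [pieceMap, map_mul, proj_toCompletion, QuotientGroup.mk_mul, QuotientGroup.mk_inv,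
    QuotientGroup.out_eq', QuotientGroup.out_eq', inv_mul_cancel_right]

theorem pieceMap_inv_pieceMap (N : FiniteIndexNormalSubgroup (FreeGroup (Fin k)))
    (τ : Equiv.Perm (FinQuot N)) (x : FreeCompletion k) :
    pieceMap N τ⁻¹ (pieceMap N τ x) = x := by
  rw [pieceMap, proj_pieceMap, pieceMap, ← mul_assoc, ← map_mul, ← Equiv.Perm.mul_apply, inv_mul_cancel,
    Equiv.Perm.one_apply]
  simp

theorem continuous_pieceMap (N : FiniteIndexNormalSubgroup (FreeGroup (Fin k)))
    (τ : Equiv.Perm (FinQuot N)) : Continuous (pieceMap N τ) := by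
  refine Continuous.mul ?_ continuous_id
  refine continuous_def.2 fun s _ => ?_
  exact (isClopen_proj_preimage N
    ((fun q : FinQuot N => toCompletion k ((τ q).out * q.out⁻¹)) ⁻¹' s)).2

/-- On each coset the map is a single left translation, and it carries the coset of q to that of `τ
q`; Haar measure is summed over cosets and reindexed by `τ`. -/
theorem haarProb_pieceMap_preimage (N : FiniteIndexNormalSubgroup (FreeGroup (Fin k)))
    (τ : Equiv.Perm (FinQuot N)) {s : Set (FreeCompletion k)} (hs : MeasurableSet s) :
    haarProb k (pieceMap N τ ⁻¹' s) = haarProb k s := by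
  classical
  have := Fintype.ofFinite (FinQuot N)
  have hdecomp : ∀ t : Set (FreeCompletion k), MeasurableSet t →
      haarProb k t = ∑ q : FinQuot N, haarProb k (t ∩ proj N ⁻¹' {q}) := by
    intro t ht
    rw [← tsum_fintype (L := .unconditional _), ← measure_iUnion]
    · congr 1
      ext x
      simp
    · intro p q hpq
      refine Set.disjoint_left.2 ?_
      rintro x ⟨-, hx⟩ ⟨-, hy⟩
      exact hpq (hx.symm.trans hy)
    · exact fun q => ht.inter (isClopen_proj_preimage N {q}).2.measurableSet
  rw [hdecomp _ ((continuous_pieceMap N τ).measurable hs), hdecomp s hs,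
    ← Equiv.sum_comp τ (fun q => haarProb k (s ∩ proj N ⁻¹' {q}))]
  refine Finset.sum_congr rfl fun q _ => ?_
  rw [← measure_preimage_mul (haarProb k) (toCompletion k ((τ q).out * q.out⁻¹))
    (s ∩ proj N ⁻¹' {τ q})]
  congr 1
  ext x
  simp only [Set.mem_inter_iff, Set.mem_preimage, Set.mem_singleton_iff]
  rw [map_mul (toCompletion k)]
  have hp : proj N (toCompletion k (τ q).out * toCompletion k q.out⁻¹ * x) =
      τ q * q⁻¹ * proj N x := by
    rw [map_mul, map_mul, proj_toCompletion, proj_toCompletion, QuotientGroup.mk_inv,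
      QuotientGroup.out_eq', QuotientGroup.out_eq']
  rw [hp]
  constructor
  · rintro ⟨h1, rfl⟩
    rw [pieceMap, map_mul] at h1
    exact ⟨h1, by simp⟩
  · rintro ⟨h1, h2⟩
    have h3 : proj N x = q := by
      rw [mul_assoc] at h2
      exact (inv_mul_eq_one.1 (mul_eq_left.1 h2)).symm
    refine ⟨?_, h3⟩
    rw [pieceMap, map_mul, h3]
    exact h1

/-- The automorphism of the measured algebra of clopen sets which realizes a permutation of a
finite quotient by a piecewise translation. -/
noncomputable def permAut (N : FiniteIndexNormalSubgroup (FreeGroup (Fin k)))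
    (τ : Equiv.Perm (FinQuot N)) : measuredAut k :=
  ⟨{ toFun := fun a => ⟨pieceMap N τ⁻¹ ⁻¹' a, a.isClopen.preimage (continuous_pieceMap N τ⁻¹)⟩
     invFun := fun a => ⟨pieceMap N τ ⁻¹' a, a.isClopen.preimage (continuous_pieceMap N τ)⟩
     left_inv := by
      intro a
      apply Clopens.ext
      ext x
      simp [pieceMap_inv_pieceMap]
     right_inv := by
      intro a
      apply Clopens.ext
      ext x
      have := pieceMap_inv_pieceMap N τ⁻¹ x
      rw [inv_inv] at this
      simp [this]
     map_rel_iff' := by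
      intro a b
      refine ⟨fun h x hx => ?_, fun h x hx => h hx⟩
      have := @h (pieceMap N τ x)
      change pieceMap N τ⁻¹ (pieceMap N τ x) ∈ a → pieceMap N τ⁻¹ (pieceMap N τ x) ∈ b at this
      rw [pieceMap_inv_pieceMap] at this
      exact this hx },
    fun a => haarProb_pieceMap_preimage N τ⁻¹ (measurableSet_clop a)⟩

theorem permAut_cyl (N : FiniteIndexNormalSubgroup (FreeGroup (Fin k)))
    (τ : Equiv.Perm (FinQuot N)) (B : Set (FinQuot N)) :
    (permAut N τ : ClopAlg k ≃o ClopAlg k) (cyl N B) = cyl N (τ '' B) := by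
  apply Clopens.ext
  ext x
  change proj N (pieceMap N τ⁻¹ x) ∈ B ↔ proj N x ∈ τ '' B
  rw [proj_pieceMap, Equiv.image_eq_preimage_symm]
  rfl

/-! ### Countability, topology and Polishness -/

instance countable_freeGroup (k : ℕ) : Countable (FreeGroup (Fin k)) :=
  (Quot.mk_surjective (r := FreeGroup.Red.Step)).countable

instance countable_finiteIndexNormalSubgroup (k : ℕ) :
    Countable (FiniteIndexNormalSubgroup (FreeGroup (Fin k))) := by
  -- A finite-index subgroup of a finitely generated group is finitely generated, hence determined
  -- by a finite subset of a countable group.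
  have hfg : ∀ N : FiniteIndexNormalSubgroup (FreeGroup (Fin k)), N.toSubgroup.FG := by
    intro N
    have := (Group.fg_iff_subgroup_fg N.toSubgroup).1 inferInstance
    exact this
  choose f hf using hfg
  refine Function.Injective.countable (f := f) fun M N h => ?_
  apply FiniteIndexNormalSubgroup.toSubgroup_injective
  change M.toSubgroup = N.toSubgroup
  rw [← hf M, ← hf N, h]

instance countable_clopAlg (k : ℕ) : Countable (ClopAlg k) := by
  have hs : Function.Surjective
      (fun p : Σ N : FiniteIndexNormalSubgroup (FreeGroup (Fin k)), Set (FinQuot N) =>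
        cyl p.1 p.2) := by
    intro a
    obtain ⟨N, hN⟩ := exists_isLevel a
    obtain ⟨B, rfl⟩ := hN.eq_cyl
    exact ⟨⟨N, B⟩, rfl⟩
  exact hs.countable

theorem isOpen_setOf_apply_mem (a : ClopAlg k) (s : Set (ClopAlg k)) :
    IsOpen {h : measuredAut k | (h : ClopAlg k ≃o ClopAlg k) a ∈ s} := by
  let _ : TopologicalSpace (ClopAlg k) := ⊥
  have : DiscreteTopology (ClopAlg k) := ⟨rfl⟩
  have hc : Continuous (fun (h : measuredAut k) (a : ClopAlg k) =>
      (h : ClopAlg k ≃o ClopAlg k) a) := continuous_induced_dom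
  exact (isOpen_discrete s).preimage ((continuous_apply a).comp hc)

theorem isOpen_setOf_apply_eq (a b : ClopAlg k) :
    IsOpen {h : measuredAut k | (h : ClopAlg k ≃o ClopAlg k) a = b} :=
  isOpen_setOf_apply_mem a {b}

theorem exists_finset_of_mem_nhds {h : measuredAut k} {U : Set (measuredAut k)}
    (hU : U ∈ nhds h) : ∃ s : Finset (ClopAlg k), ∀ g : measuredAut k,
      (∀ a ∈ s, (g : ClopAlg k ≃o ClopAlg k) a = (h : ClopAlg k ≃o ClopAlg k) a) → g ∈ U := by
  let _ : TopologicalSpace (ClopAlg k) := ⊥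
  have : DiscreteTopology (ClopAlg k) := ⟨rfl⟩
  rw [nhds_induced, Filter.mem_comap] at hU
  obtain ⟨t, ht, htU⟩ := hU
  obtain ⟨V, hVt, hV, hhV⟩ := mem_nhds_iff.1 ht
  obtain ⟨s, u, hs, hsu⟩ := isOpen_pi_iff.1 hV _ hhV
  refine ⟨s, fun g hg => htU (hVt (hsu fun a ha => ?_))⟩
  change (g : ClopAlg k ≃o ClopAlg k) a ∈ u a
  rw [hg a ha]
  exact (hs a ha).2

theorem exists_finset_of_mem_nhds_pi {ι : Type*} [Finite ι] {h : ι → measuredAut k}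
    {U : Set (ι → measuredAut k)} (hU : U ∈ nhds h) :
    ∃ s : Finset (ClopAlg k), ∀ g : ι → measuredAut k,
      (∀ i, ∀ a ∈ s, (g i : ClopAlg k ≃o ClopAlg k) a = (h i : ClopAlg k ≃o ClopAlg k) a) →
        g ∈ U := by
  classical
  have := Fintype.ofFinite ι
  rw [nhds_pi, Filter.mem_pi'] at hU
  obtain ⟨I, t, ht, htU⟩ := hU
  choose s hs using fun i => exists_finset_of_mem_nhds (ht i)
  refine ⟨Finset.univ.biUnion s, fun g hg => htU fun i _ => hs i (g i) fun a ha => hg i a ?_⟩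
  exact Finset.mem_biUnion.2 ⟨i, Finset.mem_univ i, ha⟩

theorem polishSpace_measuredAut (k : ℕ) : PolishSpace (measuredAut k) := by
  let _ : TopologicalSpace (ClopAlg k) := ⊥
  have : DiscreteTopology (ClopAlg k) := ⟨rfl⟩
  -- The inverse is recorded as well because surjectivity alone is not a closed condition, whereas
  -- being mutually inverse is.
  let e : measuredAut k → (ClopAlg k → ClopAlg k) × (ClopAlg k → ClopAlg k) := fun h =>
    ((fun a => (h : ClopAlg k ≃o ClopAlg k) a), (fun a => (h : ClopAlg k ≃o ClopAlg k).symm a))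
  have h1 : Continuous (fun h : measuredAut k => (e h).1) := continuous_induced_dom
  have h2 : Continuous (fun h : measuredAut k => (e h).2) := by
    refine continuous_pi fun a => (continuous_discrete_rng).2 fun b => ?_
    convert isOpen_setOf_apply_eq b a using 1
    ext h
    exact (OrderIso.symm_apply_eq _).trans eq_comm
  have hind : Topology.IsInducing e := by
    refine ⟨le_antisymm (h1.prodMk h2).le_induced ?_⟩
    have : instTopologicalSpaceMeasuredAut k = TopologicalSpace.induced (Prod.fst ∘ e)
      inferInstance := rfl
    rw [this, ← induced_compose]
    exact induced_mono continuous_fst.le_induced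
  have hinj : Function.Injective e := by
    intro g h hgh
    apply Subtype.ext
    apply RelIso.ext
    exact fun a => congrFun (congrArg Prod.fst hgh) a
  have hrange : Set.range e = {p | (∀ a, p.1 (p.2 a) = a) ∧ (∀ a, p.2 (p.1 a) = a) ∧
      (∀ a b, p.1 a ≤ p.1 b ↔ a ≤ b) ∧
      ∀ a : ClopAlg k, haarProb k (p.1 a : Set (FreeCompletion k)) = haarProb k (a : Set (FreeCompletion k))} := by
    ext p
    constructor
    · rintro ⟨h, rfl⟩
      exact ⟨fun a => (h : ClopAlg k ≃o ClopAlg k).apply_symm_apply a,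
        fun a => (h : ClopAlg k ≃o ClopAlg k).symm_apply_apply a,
        fun a b => (h : ClopAlg k ≃o ClopAlg k).le_iff_le, h.2⟩
    · rintro ⟨ha, hb, hc, hd⟩
      exact ⟨⟨⟨⟨p.1, p.2, hb, ha⟩, hc _ _⟩, hd⟩, rfl⟩
  have hcl : IsClosed (Set.range e) := by
    have c1 : ∀ a, Continuous fun p : (ClopAlg k → ClopAlg k) × (ClopAlg k → ClopAlg k) =>
        p.1 a := fun a => (continuous_apply a).comp continuous_fst
    have c2 : ∀ a, Continuous fun p : (ClopAlg k → ClopAlg k) × (ClopAlg k → ClopAlg k) =>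
        p.2 a := fun a => (continuous_apply a).comp continuous_snd
    have cl : ∀ (f : ((ClopAlg k → ClopAlg k) × (ClopAlg k → ClopAlg k)) → ClopAlg k × ClopAlg k),
        Continuous f → ∀ q : ClopAlg k × ClopAlg k → Prop, IsClosed {p | q (f p)} :=
      fun f hf q => (isClosed_discrete {x | q x}).preimage hf
    have ev1 : ∀ a, IsClosed {p : (ClopAlg k → ClopAlg k) × (ClopAlg k → ClopAlg k) |
        p.1 (p.2 a) = a} := by
      intro a
      -- Naming the intermediate value b turns the composition into conditions on two fixed
      -- coordinates, each of them clopen.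
      have : {p : (ClopAlg k → ClopAlg k) × (ClopAlg k → ClopAlg k) | p.1 (p.2 a) = a} =
          ⋂ b, {p | p.2 a = b → p.1 b = a} := by
        ext p
        simp
      rw [this]
      exact isClosed_iInter fun b => cl _ ((c2 a).prodMk (c1 b)) fun x => x.1 = b → x.2 = a
    have ev2 : ∀ a, IsClosed {p : (ClopAlg k → ClopAlg k) × (ClopAlg k → ClopAlg k) |
        p.2 (p.1 a) = a} := by
      intro a
      have : {p : (ClopAlg k → ClopAlg k) × (ClopAlg k → ClopAlg k) | p.2 (p.1 a) = a} =
          ⋂ b, {p | p.1 a = b → p.2 b = a} := by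
        ext p
        simp
      rw [this]
      exact isClosed_iInter fun b => cl _ ((c1 a).prodMk (c2 b)) fun x => x.1 = b → x.2 = a
    rw [hrange]
    simp only [Set.ofPred_and, Set.ofPred_forall]
    refine (isClosed_iInter ev1).inter ((isClosed_iInter ev2).inter (IsClosed.inter ?_ ?_))
    · exact isClosed_iInter fun a => isClosed_iInter fun b =>
        cl _ ((c1 a).prodMk (c1 b)) fun x => x.1 ≤ x.2 ↔ a ≤ b
    · exact isClosed_iInter fun a => cl _ ((c1 a).prodMk (c1 a)) fun x =>
        haarProb k (x.1 : Set (FreeCompletion k)) = haarProb k (a : Set (FreeCompletion k))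
  have hsc : SecondCountableTopology (ClopAlg k) := inferInstance
  exact (Topology.IsClosedEmbedding.mk ⟨hind, hinj⟩ hcl).polishSpace

theorem mem_fixedPointFree {h : Fin k → measuredAut k} :
    h ∈ fixedPointFree k ↔
      ∀ a : ClopAlg k, (∀ i, (h i : ClopAlg k ≃o ClopAlg k) a = a) → a = ⊥ ∨ a = ⊤ := by
  simp only [fixedPointFree, Set.mem_iInter, Set.mem_iUnion, Set.mem_ofPred_eq]
  refine forall_congr' fun a => ?_
  rw [← not_imp_not, not_exists]
  simp only [not_not]
  tauto

/-- Moving a given clopen set is a closed condition since values are discrete; finiteness of the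
number of generators keeps the union closed. -/
theorem isClosed_fixedPointFree (k : ℕ) : IsClosed (fixedPointFree k) := by
  refine isClosed_iInter fun a => isClosed_iInter fun _ => isClosed_iUnion_of_finite fun i => ?_
  refine IsClosed.preimage (f := fun h : Fin k → measuredAut k => h i) (continuous_apply i)
    (t := {h : measuredAut k | (h : ClopAlg k ≃o ClopAlg k) a ≠ a}) ?_
  exact ⟨by simpa [Set.compl_ofPred] using isOpen_setOf_apply_eq a a⟩

theorem polishSpace_fixedPointFree (k : ℕ) : PolishSpace (fixedPointFree k) := by
  have := polishSpace_measuredAut k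
  exact (isClosed_fixedPointFree k).polishSpace

/-! ### Merging orbits of permutations -/

section Merge
variable {ι Q T : Type*}

/-- The partition of a set into the orbits of a family of permutations. -/
def orbitSetoid (σ : ι → Equiv.Perm Q) : Setoid Q :=
  Relation.EqvGen.setoid fun x y => ∃ i, σ i x = y

theorem orbitSetoid_apply (σ : ι → Equiv.Perm Q) (i : ι) (x : Q) :
    orbitSetoid σ x (σ i x) := Relation.EqvGen.rel _ _ ⟨i, rfl⟩

/-- Precomposing with the swap splices the `σ i`-cycles of x and y into one cycle, so two orbits
merge and none is broken. -/
theorem orbitSetoid_swap [Finite Q] [DecidableEq Q] [DecidableEq ι] (σ : ι → Equiv.Perm Q) (i : ι)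
    {x y : Q} (hxy : ¬ orbitSetoid σ x y) :
    orbitSetoid σ < orbitSetoid (Function.update σ i (σ i * Equiv.swap x y)) := by
  set σ' := Function.update σ i (σ i * Equiv.swap x y) with hσ'
  have hi : ∀ z, σ' i z = σ i (Equiv.swap x y z) := fun z => by simp [hσ']
  -- Starting at `σ i x`, the old and new permutations agree until x is reached: the `σ i`-cycle of
  -- x avoids y, which lies in another orbit. The cycle is finite, so x is reached.
  have key : orbitSetoid σ' (σ i x) x := by
    by_contra hcon
    have hclosed : ∀ z, orbitSetoid σ' (σ i x) z ∧ orbitSetoid σ x z →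
        orbitSetoid σ' (σ i x) (σ i z) ∧ orbitSetoid σ x (σ i z) := by
      rintro z ⟨h1, h2⟩
      refine ⟨?_, (orbitSetoid σ).trans h2 (orbitSetoid_apply σ i z)⟩
      have hzx : z ≠ x := by rintro rfl; exact hcon h1
      have hzy : z ≠ y := by rintro rfl; exact hxy h2
      have := orbitSetoid_apply σ' i z
      rw [hi, Equiv.swap_apply_of_ne_of_ne hzx hzy] at this
      exact (orbitSetoid σ').trans h1 this
    have hpow : ∀ n : ℕ, orbitSetoid σ' (σ i x) ((σ i ^ (n + 1)) x) ∧
        orbitSetoid σ x ((σ i ^ (n + 1)) x) := by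
      intro n
      induction n with
      | zero =>
        rw [zero_add, pow_one]
        exact ⟨(orbitSetoid σ').refl _, orbitSetoid_apply σ i x⟩
      | succ n ih =>
        rw [pow_succ', Equiv.Perm.mul_apply]
        exact hclosed _ ih
    obtain ⟨n, hn, hn1⟩ := (isOfFinOrder_of_finite (σ i)).exists_pow_eq_one
    obtain ⟨m, rfl⟩ := Nat.exists_eq_succ_of_ne_zero hn.ne'
    have := (hpow m).1
    rw [hn1] at this
    exact hcon this
  have hyx : orbitSetoid σ' y (σ i x) := by
    have := orbitSetoid_apply σ' i y
    rwa [hi, Equiv.swap_apply_right] at this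
  have hxy' : orbitSetoid σ' x (σ i y) := by
    have := orbitSetoid_apply σ' i x
    rwa [hi, Equiv.swap_apply_left] at this
  have hyx' : orbitSetoid σ' y x := (orbitSetoid σ').trans hyx key
  refine lt_of_le_of_ne ?_ ?_
  · refine Setoid.eqvGen_le ?_
    rintro z _ ⟨j, rfl⟩
    by_cases hj : j = i
    · subst hj
      by_cases hzx : z = x
      · subst hzx
        exact (orbitSetoid σ').symm key
      · by_cases hzy : z = y
        · subst hzy
          exact (orbitSetoid σ').trans hyx' hxy'
        · have := orbitSetoid_apply σ' j z
          rwa [hi, Equiv.swap_apply_of_ne_of_ne hzx hzy] at this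
    · have := orbitSetoid_apply σ' j z
      rwa [hσ', Function.update_of_ne hj] at this
  · intro heq
    rw [heq] at hxy
    exact hxy ((orbitSetoid σ').symm hyx')

/-- If every set which is saturated for `t` and invariant under a family of permutations is
trivial, then the family can be made transitive by composing with permutations preserving `t`. -/
theorem exists_transitive_mul [Finite Q] [Finite ι] [Nonempty ι] (t : Q → T)
    (σ : ι → Equiv.Perm Q)
    (h : ∀ O : Set Q, (∀ x y, t x = t y → x ∈ O → y ∈ O) → (∀ i, σ i '' O = O) →
      O = ∅ ∨ O = Set.univ) :
    ∃ τ : ι → Equiv.Perm Q, (∀ i x, t (τ i x) = t x) ∧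
      orbitSetoid (fun i => σ i * τ i) = ⊤ := by
  classical
  let A : Set (ι → Equiv.Perm Q) := {τ | ∀ i x, t (τ i x) = t x}
  -- Choose a fibre-preserving correction with orbit partition as coarse as possible. A fibre
  -- meeting two orbits would allow a further swap inside it, contradicting maximality.
  obtain ⟨τ, hτ, hmax⟩ := (Set.toFinite A).exists_maximalFor
    (fun τ => orbitSetoid (fun i => σ i * τ i)) A ⟨1, fun i x => rfl⟩
  refine ⟨τ, hτ, ?_⟩
  have hsat : ∀ x y, t x = t y → orbitSetoid (fun i => σ i * τ i) x y := by
    intro x y hxy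
    by_contra hcon
    obtain ⟨i⟩ := ‹Nonempty ι›
    have hlt := orbitSetoid_swap (fun i => σ i * τ i) i hcon
    have hmem : Function.update τ i (τ i * Equiv.swap x y) ∈ A := by
      intro j z
      by_cases hj : j = i
      · subst hj
        rw [Function.update_self, Equiv.Perm.mul_apply, hτ]
        by_cases hzx : z = x
        · rw [hzx, Equiv.swap_apply_left, hxy]
        · by_cases hzy : z = y
          · rw [hzy, Equiv.swap_apply_right, hxy]
          · rw [Equiv.swap_apply_of_ne_of_ne hzx hzy]
      · rw [Function.update_of_ne hj]
        exact hτ j z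
    have heq : (fun j => σ j * Function.update τ i (τ i * Equiv.swap x y) j) =
        Function.update (fun i => σ i * τ i) i (σ i * τ i * Equiv.swap x y) := by
      ext j z
      by_cases hj : j = i
      · subst hj
        simp
      · simp [Function.update_of_ne hj]
    rw [← heq] at hlt
    exact hlt.not_ge (hmax hmem hlt.le)
  rw [Setoid.eq_top_iff]
  intro x y
  let O : Set Q := {z | orbitSetoid (fun i => σ i * τ i) x z}
  -- Fibres now lie inside orbits, so `τ` can be undone within an orbit: each orbit is saturated and
  -- invariant under the original `σ`.
  have hO : O = ∅ ∨ O = Set.univ := by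
    refine h O (fun y z hyz hy => (orbitSetoid _).trans hy (hsat y z hyz)) fun i => ?_
    have hsub : σ i '' O ⊆ O := by
      rintro _ ⟨z, hz, rfl⟩
      have h1 : orbitSetoid (fun i => σ i * τ i) z ((τ i)⁻¹ z) := by
        refine hsat _ _ ?_
        rw [← hτ i ((τ i)⁻¹ z)]
        simp
      have h2 := orbitSetoid_apply (fun i => σ i * τ i) i ((τ i)⁻¹ z)
      simp only [Equiv.Perm.mul_apply] at h2
      rw [← Equiv.Perm.mul_apply (τ i), mul_inv_cancel, Equiv.Perm.one_apply] at h2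
      exact (orbitSetoid _).trans hz ((orbitSetoid _).trans h1 h2)
    exact Set.eq_of_subset_of_ncard_le hsub
      (Set.ncard_image_of_injective O (σ i).injective).ge (Set.toFinite O)
  rcases hO with hO | hO
  · exact absurd (hO ▸ (orbitSetoid _).refl x : x ∈ (∅ : Set Q)) (Set.notMem_empty x)
  · exact (hO ▸ Set.mem_univ y : y ∈ O)

end Merge

/-! ### Density of the conjugacy class -/

theorem exists_lift_apply_eq {Q : Type*} (σ : Fin k → Equiv.Perm Q) {x y : Q}
    (h : orbitSetoid σ x y) : ∃ w, FreeGroup.lift σ w x = y := by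
  induction h with
  | rel x y h =>
    obtain ⟨i, rfl⟩ := h
    exact ⟨FreeGroup.of i, by rw [FreeGroup.lift_apply_of]⟩
  | refl x => exact ⟨1, by simp⟩
  | symm x y _ ih =>
    obtain ⟨w, rfl⟩ := ih
    exact ⟨w⁻¹, by rw [map_inv, ← Equiv.Perm.mul_apply, inv_mul_cancel, Equiv.Perm.one_apply]⟩
  | trans x y z _ _ ih1 ih2 =>
    obtain ⟨v, rfl⟩ := ih1
    obtain ⟨w, rfl⟩ := ih2
    exact ⟨w * v, by rw [map_mul, Equiv.Perm.mul_apply]⟩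

/-- Two maps with fibres of equal cardinality differ by a permutation. -/
theorem exists_perm_comp_eq {Q T : Type*} [Finite Q] (f g : Q → T)
    (h : ∀ c, (f ⁻¹' {c}).ncard = (g ⁻¹' {c}).ncard) :
    ∃ τ : Equiv.Perm Q, ∀ q, g (τ q) = f q := by
  have e : ∀ c, Nonempty ({q // f q = c} ≃ {q // g q = c}) := fun c =>
    Finite.card_eq.1 (h c)
  exact ⟨Equiv.ofFiberEquiv fun c => (e c).some, fun q => Equiv.ofFiberEquiv_map _ q⟩

/-- A map which intertwines a family of permutations with a transitive family has fibres of
equal cardinality. -/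
theorem ncard_fiber_eq {G P Q : Type*} [Group G] [Finite P] [Finite Q] (π : G →* Equiv.Perm P)
    (ρ : G →* Equiv.Perm Q) (f : P → Q) (hf : ∀ g p, f (π g p) = ρ g (f p))
    (hρ : ∀ x y, ∃ g, ρ g x = y) (c : Q) :
    (f ⁻¹' {c}).ncard * Nat.card Q = Nat.card P := by
  classical
  have := Fintype.ofFinite Q
  have hc : ∀ d, Nat.card {p // f p = d} = (f ⁻¹' {c}).ncard := by
    intro d
    obtain ⟨g, rfl⟩ := hρ c d
    have : {p | f p = ρ g c} = π g '' (f ⁻¹' {c}) := by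
      ext p
      rw [Equiv.image_eq_preimage_symm]
      have := hf g ((π g).symm p)
      rw [Equiv.apply_symm_apply] at this
      simp [this]
    rw [← Set.ncard_image_of_injective (f ⁻¹' {c}) (π g).injective, ← this]
    rfl
  rw [← Nat.card_congr (Equiv.sigmaFiberEquiv f), Nat.card_sigma]
  simp [hc, mul_comm]

/-- The projection between finite quotients. -/
def finQuotMap {M N : FiniteIndexNormalSubgroup (FreeGroup (Fin k))} (h : M ≤ N) :
    FinQuot M → FinQuot N :=
  QuotientGroup.map _ _ (MonoidHom.id _) (h : M.toSubgroup ≤ N.toSubgroup)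

theorem cyl_finQuotMap_preimage {M N : FiniteIndexNormalSubgroup (FreeGroup (Fin k))} (h : M ≤ N)
    (B : Set (FinQuot N)) : cyl M (finQuotMap h ⁻¹' B) = cyl N B :=
  trace_injective (by ext w; rfl)

/-- A transitive family of permutations of a finite quotient is realized by a conjugate of the
canonical action. -/
theorem exists_diagConjClass_cyl (N : FiniteIndexNormalSubgroup (FreeGroup (Fin k)))
    (σ : Fin k → Equiv.Perm (FinQuot N)) (hσ : orbitSetoid σ = ⊤) :
    ∃ g ∈ diagConjClass (fun i => freeAction k (FreeGroup.of i)), ∀ i B,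
      (g i : ClopAlg k ≃o ClopAlg k) (cyl N B) = cyl N (σ i '' B) := by
  let K : FiniteIndexNormalSubgroup (FreeGroup (Fin k)) :=
    FiniteIndexNormalSubgroup.ofSubgroup (FreeGroup.lift σ).ker
  -- On F/M both the projection to F/N and the orbit map w ↦ `lift σ w 1` are defined. Both are
  -- equivariant onto transitive actions on the same set, so their fibres all have the same
  -- cardinality.
  let M := K ⊓ N
  let π : FreeGroup (Fin k) →* Equiv.Perm (FinQuot M) := MulAction.toPermHom _ _
  let α : FinQuot M → FinQuot N := finQuotMap inf_le_right
  let β : FinQuot M → FinQuot N := fun q => QuotientGroup.lift M.toSubgroup (FreeGroup.lift σ)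
    (fun w hw => hw.1) q 1
  have hα : ∀ c, (α ⁻¹' {c}).ncard * Nat.card (FinQuot N) = Nat.card (FinQuot M) := by
    refine ncard_fiber_eq π (MulAction.toPermHom (FreeGroup (Fin k)) (FinQuot N)) α ?_ ?_
    · rintro g ⟨w⟩
      rfl
    · rintro x y
      exact MulAction.exists_smul_eq _ x y
  have hβ' : ∀ g p, β (π g p) = FreeGroup.lift σ g (β p) := by
    rintro g ⟨w⟩
    change FreeGroup.lift σ (g * w) 1 = _
    rw [map_mul]
    rfl
  have hβ : ∀ c, (β ⁻¹' {c}).ncard * Nat.card (FinQuot N) = Nat.card (FinQuot M) := by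
    refine ncard_fiber_eq π (FreeGroup.lift σ) β hβ' fun x y => exists_lift_apply_eq σ ?_
    rw [hσ]
    exact True.intro
  obtain ⟨τ, hτ⟩ := exists_perm_comp_eq α β fun c =>
    Nat.eq_of_mul_eq_mul_right Nat.card_pos ((hα c).trans (hβ c).symm)
  -- The permutation `τ` carries fibres of `α` to fibres of `β`, so conjugating by its piecewise
  -- translation replaces translation on F/N by `σ`.
  have hφ : ∀ B, (permAut M τ : ClopAlg k ≃o ClopAlg k) (cyl N B) = cyl M (β ⁻¹' B) := by
    intro B
    rw [← cyl_finQuotMap_preimage (inf_le_right : M ≤ N), permAut_cyl]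
    congr 1
    ext q
    have hq := hτ (τ.symm q)
    rw [Equiv.apply_symm_apply] at hq
    rw [Equiv.image_eq_preimage_symm, Set.mem_preimage, Set.mem_preimage, Set.mem_preimage, hq]
  refine ⟨fun i => (permAut M τ)⁻¹ * freeAction k (FreeGroup.of i) * permAut M τ,
    ⟨(permAut M τ)⁻¹, fun i => by rw [inv_inv]⟩, fun i B => ?_⟩
  change (permAut M τ : ClopAlg k ≃o ClopAlg k).symm
    ((freeAction k (FreeGroup.of i) : ClopAlg k ≃o ClopAlg k)
      ((permAut M τ : ClopAlg k ≃o ClopAlg k) (cyl N B))) = _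
  rw [OrderIso.symm_apply_eq, hφ, hφ, freeAction_cyl]
  congr 1
  have himage : (fun q : FinQuot M => (FreeGroup.of i : FinQuot M) * q) '' (β ⁻¹' B) =
      π (FreeGroup.of i) '' (β ⁻¹' B) := rfl
  rw [himage, Equiv.image_eq_preimage_symm, Equiv.image_eq_preimage_symm]
  ext q
  have := hβ' (FreeGroup.of i) ((π (FreeGroup.of i)).symm q)
  rw [Equiv.apply_symm_apply, FreeGroup.lift_apply_of] at this
  simp only [Set.mem_preimage]
  rw [this, Equiv.symm_apply_apply]

/-- An automorphism of the measured algebra agrees with a permutation of a fine finite quotient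
on the clopen sets coming from a coarser one. -/
theorem exists_perm_cyl {M N : FiniteIndexNormalSubgroup (FreeGroup (Fin k))} (hNM : N ≤ M)
    (h : measuredAut k) (hh : ∀ B, IsLevel N ((h : ClopAlg k ≃o ClopAlg k) (cyl M B))) :
    ∃ τ : Equiv.Perm (FinQuot N), ∀ B,
      (h : ClopAlg k ≃o ClopAlg k) (cyl M B) = cyl N (τ '' (finQuotMap hNM ⁻¹' B)) := by
  choose D hD using fun B => (hh B).eq_cyl
  have hempty : D ∅ = ∅ := cyl_injective N (by rw [← hD, cyl_empty, cyl_empty, map_bot])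
  have huniv : D Set.univ = Set.univ :=
    cyl_injective N (by rw [← hD, cyl_univ, cyl_univ, map_top])
  have hunion : ∀ B C, D (B ∪ C) = D B ∪ D C := fun B C =>
    cyl_injective N (by rw [← hD, cyl_union, cyl_union, map_sup, hD, hD])
  have hinter : ∀ B C, D (B ∩ C) = D B ∩ D C := fun B C =>
    cyl_injective N (by rw [← hD, cyl_inter, cyl_inter, map_inf, hD, hD])
  have hmem : ∀ B q, q ∈ D B ↔ ∃ c ∈ B, q ∈ D {c} := by
    intro B q
    induction B, Set.toFinite B using Set.Finite.induction_on with
    | empty => simp [hempty]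
    | @insert c B _ _ ih =>
      rw [Set.insert_eq, hunion, Set.mem_union, ih]
      simp
  have hex : ∀ q, ∃ c, q ∈ D {c} := fun q => by
    obtain ⟨c, -, hc⟩ := (hmem Set.univ q).1 (huniv ▸ Set.mem_univ q)
    exact ⟨c, hc⟩
  -- Finite duality: the Boolean homomorphism `D` is the preimage map of a point map g from F/N to
  -- F/M. Preservation of measure gives g the same fibre sizes as the projection.
  choose g hg using hex
  have hgD : ∀ B, D B = g ⁻¹' B := by
    intro B
    ext q
    rw [hmem]
    refine ⟨?_, fun hq => ⟨g q, hq, hg q⟩⟩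
    rintro ⟨c, hc, hqc⟩
    by_contra hgq
    have hne : ({c} : Set (FinQuot M)) ∩ {g q} = ∅ := by
      rw [Set.singleton_inter_eq_empty]
      rintro rfl
      exact hgq hc
    have hq : q ∈ D ({c} ∩ {g q}) := hinter _ _ ▸ ⟨hqc, hg q⟩
    rw [hne, hempty] at hq
    exact hq
  obtain ⟨τ, hτ⟩ := exists_perm_comp_eq (finQuotMap hNM) g fun c => by
    refine ncard_eq_of_haarProb_eq ?_
    rw [cyl_finQuotMap_preimage, ← hgD, ← hD]
    exact (h.2 _).symm
  refine ⟨τ, fun B => ?_⟩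
  rw [hD, hgD]
  congr 1
  ext q
  rw [Equiv.image_eq_preimage_symm, Set.mem_preimage, Set.mem_preimage, Set.mem_preimage, ← hτ,
    Equiv.apply_symm_apply]

/-- The conjugacy class of the canonical action is dense among the tuples without nontrivial
common fixed points. -/
theorem exists_diagConjClass_eqOn {h : Fin k → measuredAut k} (hh : h ∈ fixedPointFree k)
    (s : Finset (ClopAlg k)) :
    ∃ g ∈ diagConjClass (fun i => freeAction k (FreeGroup.of i)), ∀ i, ∀ a ∈ s,
      (g i : ClopAlg k ≃o ClopAlg k) a = (h i : ClopAlg k ≃o ClopAlg k) a := by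
  classical
  rcases isEmpty_or_nonempty (Fin k) with hk | hk
  -- With no generators there is only one tuple; otherwise some generator is available to absorb the
  -- swaps.
  · exact ⟨h, ⟨1, fun i => hk.elim i⟩, fun i => hk.elim i⟩
  obtain ⟨M, hM⟩ := exists_isLevel_finset s
  have := Fintype.ofFinite (Set (FinQuot M))
  obtain ⟨L, hL⟩ := exists_isLevel_finset (Finset.univ.biUnion fun i =>
    Finset.univ.image fun B : Set (FinQuot M) => (h i : ClopAlg k ≃o ClopAlg k) (cyl M B))
  let N := L ⊓ M
  have hNM : N ≤ M := inf_le_right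
  have hN : ∀ i B, IsLevel N ((h i : ClopAlg k ≃o ClopAlg k) (cyl M B)) := fun i B =>
    (hL _ (Finset.mem_biUnion.2 ⟨i, Finset.mem_univ i,
      Finset.mem_image_of_mem _ (Finset.mem_univ B)⟩)).mono inf_le_left
  choose σ hσ using fun i => exists_perm_cyl hNM (h i) (hN i)
  obtain ⟨τ, hτ, htrans⟩ := exists_transitive_mul (finQuotMap hNM) σ (by
    intro O hO hinv
    have hsat : finQuotMap hNM ⁻¹' (finQuotMap hNM '' O) = O := by
      refine Set.Subset.antisymm ?_ (Set.subset_preimage_image _ _)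
      rintro x ⟨y, hy, hyx⟩
      exact hO y x hyx hy
    have hfix := mem_fixedPointFree.1 hh (cyl M (finQuotMap hNM '' O)) fun i => by
      rw [hσ, hsat, hinv, ← cyl_finQuotMap_preimage hNM, hsat]
    rw [← cyl_finQuotMap_preimage hNM, hsat] at hfix
    exact hfix.imp (fun h => cyl_injective N h) fun h => cyl_injective N h)
  obtain ⟨g, hg, hgN⟩ := exists_diagConjClass_cyl N (fun i => σ i * τ i) htrans
  refine ⟨g, hg, fun i a ha => ?_⟩
  obtain ⟨B, rfl⟩ := (hM a ha).eq_cyl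
  rw [hσ, ← cyl_finQuotMap_preimage hNM, hgN]
  congr 1
  rw [Equiv.Perm.coe_mul, Set.image_comp]
  congr 1
  ext q
  rw [Equiv.image_eq_preimage_symm, Set.mem_preimage, Set.mem_preimage, Set.mem_preimage,
    ← hτ i ((τ i).symm q), Equiv.apply_symm_apply]

/-! ### Words, orbits and the open conditions -/

/-- The action of a word on clopen sets through a tuple of automorphisms. -/
def wordMap (h : Fin k → measuredAut k) (w : FreeGroup (Fin k)) : ClopAlg k ≃o ClopAlg k :=
  (FreeGroup.lift h w : measuredAut k)

theorem wordMap_of (h : Fin k → measuredAut k) (i : Fin k) (a : ClopAlg k) :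
    wordMap h (FreeGroup.of i) a = (h i : ClopAlg k ≃o ClopAlg k) a := by
  rw [wordMap, FreeGroup.lift_apply_of]

theorem wordMap_one (h : Fin k → measuredAut k) (a : ClopAlg k) : wordMap h 1 a = a := by
  rw [wordMap, map_one]
  rfl

theorem wordMap_mul (h : Fin k → measuredAut k) (v w : FreeGroup (Fin k)) (a : ClopAlg k) :
    wordMap h (v * w) a = wordMap h v (wordMap h w a) := by
  rw [wordMap, map_mul]
  rfl

theorem wordMap_inv_wordMap (h : Fin k → measuredAut k) (w : FreeGroup (Fin k)) (a : ClopAlg k) :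
    wordMap h w⁻¹ (wordMap h w a) = a := by
  rw [← wordMap_mul, inv_mul_cancel, wordMap_one]

theorem wordMap_wordMap_inv (h : Fin k → measuredAut k) (w : FreeGroup (Fin k)) (a : ClopAlg k) :
    wordMap h w (wordMap h w⁻¹ a) = a := by
  rw [← wordMap_mul, mul_inv_cancel, wordMap_one]

/-- The orbit of a clopen set under a tuple of automorphisms. -/
def wordOrbit (h : Fin k → measuredAut k) (a : ClopAlg k) : Set (ClopAlg k) :=
  Set.range fun w => wordMap h w a

theorem wordMap_mem_wordOrbit (h : Fin k → measuredAut k) (w : FreeGroup (Fin k))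
    {a b : ClopAlg k} (hb : b ∈ wordOrbit h a) : wordMap h w b ∈ wordOrbit h a := by
  obtain ⟨v, rfl⟩ := hb
  exact ⟨w * v, wordMap_mul h w v a⟩

theorem self_mem_wordOrbit (h : Fin k → measuredAut k) (a : ClopAlg k) : a ∈ wordOrbit h a :=
  ⟨1, wordMap_one h a⟩

theorem wordMap_eq_of_eqOn_wordOrbit {g h : Fin k → measuredAut k} {a : ClopAlg k}
    (hgh : ∀ i, ∀ b ∈ wordOrbit h a,
      (g i : ClopAlg k ≃o ClopAlg k) b = (h i : ClopAlg k ≃o ClopAlg k) b)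
    (w : FreeGroup (Fin k)) : ∀ b ∈ wordOrbit h a, wordMap g w b = wordMap h w b := by
  induction w using FreeGroup.induction_on with
  | C1 => intro b _; rw [wordMap_one, wordMap_one]
  | of i => intro b hb; rw [wordMap_of, wordMap_of, hgh i b hb]
  | inv_of i ih =>
    intro b hb
    apply (wordMap g (FreeGroup.of i)).injective
    rw [wordMap_wordMap_inv, ih _ (wordMap_mem_wordOrbit h _ hb), wordMap_wordMap_inv]
  | mul v w hv hw =>
    intro b hb
    rw [wordMap_mul, wordMap_mul, hw b hb, hv _ (wordMap_mem_wordOrbit h _ hb)]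

/-- The action of all words on a finite orbit is determined by the values of the generators on that
orbit, which are finitely many open constraints. -/
theorem isOpen_of_finite_wordOrbit {P : Set (Fin k → measuredAut k)}
    (hP : ∀ h ∈ P, ∃ a, (wordOrbit h a).Finite ∧ ∀ g : Fin k → measuredAut k,
      (∀ w, wordMap g w a = wordMap h w a) → g ∈ P) : IsOpen P := by
  rw [isOpen_iff_mem_nhds]
  intro h hh
  obtain ⟨a, ha, hg⟩ := hP h hh
  have hU : IsOpen (⋂ i, ⋂ b ∈ wordOrbit h a, {g : Fin k → measuredAut k |
      (g i : ClopAlg k ≃o ClopAlg k) b = (h i : ClopAlg k ≃o ClopAlg k) b}) := by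
    refine isOpen_iInter_of_finite fun i => ha.isOpen_biInter fun b _ => ?_
    exact IsOpen.preimage (f := fun g : Fin k → measuredAut k => g i) (continuous_apply i)
      (isOpen_setOf_apply_eq b ((h i : ClopAlg k ≃o ClopAlg k) b))
  refine Filter.mem_of_superset (hU.mem_nhds ?_) fun g hgU => hg g fun w => ?_
  · simp
  · refine wordMap_eq_of_eqOn_wordOrbit (fun i b hb => ?_) w a (self_mem_wordOrbit h a)
    simp only [Set.mem_iInter] at hgU
    exact hgU i b hb

/-- The tuples for which a given clopen set has a finite orbit. -/
def finiteOrbitSet (a : ClopAlg k) : Set (Fin k → measuredAut k) := {h | (wordOrbit h a).Finite}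

/-- The tuples for which some nonempty clopen set with finite orbit is moved off itself by all the
words outside of a given subgroup. -/
def wanderingSet (N : FiniteIndexNormalSubgroup (FreeGroup (Fin k))) :
    Set (Fin k → measuredAut k) :=
  {h | ∃ a, a ≠ ⊥ ∧ (wordOrbit h a).Finite ∧ ∀ w, wordMap h w a ⊓ a ≠ ⊥ → w ∈ N}

theorem isOpen_finiteOrbitSet (a : ClopAlg k) : IsOpen (finiteOrbitSet a) :=
  isOpen_of_finite_wordOrbit fun h hh => ⟨a, hh, fun g hg => by
    have : wordOrbit g a = wordOrbit h a := congrArg Set.range (funext hg)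
    rw [finiteOrbitSet, Set.mem_ofPred_eq, this]
    exact hh⟩

theorem isOpen_wanderingSet (N : FiniteIndexNormalSubgroup (FreeGroup (Fin k))) :
    IsOpen (wanderingSet N) :=
  isOpen_of_finite_wordOrbit fun h ⟨a, ha, hfin, hN⟩ => ⟨a, hfin, fun g hg => by
    have : wordOrbit g a = wordOrbit h a := congrArg Set.range (funext hg)
    refine ⟨a, ha, this ▸ hfin, fun w => ?_⟩
    rw [hg]
    exact hN w⟩

theorem exists_wordMap_conj {q : Fin k → measuredAut k}
    (hq : q ∈ diagConjClass (fun i => freeAction k (FreeGroup.of i))) :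
    ∃ φ : ClopAlg k ≃o ClopAlg k, ∀ w a,
      wordMap q w (φ a) = φ ((freeAction k w : ClopAlg k ≃o ClopAlg k) a) := by
  obtain ⟨φ, hφ⟩ := hq
  have key : FreeGroup.lift q = (MulAut.conj φ).toMonoidHom.comp (freeAction k) := by
    refine FreeGroup.ext_hom _ _ fun i => ?_
    rw [FreeGroup.lift_apply_of, hφ]
    rfl
  refine ⟨φ, fun w a => ?_⟩
  rw [wordMap, key]
  change (φ : ClopAlg k ≃o ClopAlg k) ((freeAction k w : ClopAlg k ≃o ClopAlg k)
    ((φ : ClopAlg k ≃o ClopAlg k).symm ((φ : ClopAlg k ≃o ClopAlg k) a))) = _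
  rw [OrderIso.symm_apply_apply]

theorem finite_range_freeAction (a : ClopAlg k) :
    (Set.range fun w => (freeAction k w : ClopAlg k ≃o ClopAlg k) a).Finite := by
  obtain ⟨N, hN⟩ := exists_isLevel a
  obtain ⟨B, rfl⟩ := hN.eq_cyl
  refine (Set.finite_range (cyl N)).subset ?_
  rintro _ ⟨w, rfl⟩
  exact ⟨_, (freeAction_cyl N w B).symm⟩

theorem diagConjClass_subset_finiteOrbitSet (a : ClopAlg k) :
    diagConjClass (fun i => freeAction k (FreeGroup.of i)) ⊆ finiteOrbitSet a := by
  intro q hq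
  obtain ⟨φ, hφ⟩ := exists_wordMap_conj hq
  refine ((finite_range_freeAction (φ.symm a)).image φ).subset ?_
  rintro _ ⟨w, rfl⟩
  exact ⟨_, ⟨w, rfl⟩, by simpa using (hφ w (φ.symm a)).symm⟩

/-- For the canonical action the closure of N is a witness: its translate by w meets it only if w
lies in N. The conjugating automorphism transports it. -/
theorem diagConjClass_subset_wanderingSet (N : FiniteIndexNormalSubgroup (FreeGroup (Fin k))) :
    diagConjClass (fun i => freeAction k (FreeGroup.of i)) ⊆ wanderingSet N := by
  intro q hq
  obtain ⟨φ, hφ⟩ := exists_wordMap_conj hq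
  refine ⟨φ (cyl N {1}), ?_, diagConjClass_subset_finiteOrbitSet _ hq, fun w hw => ?_⟩
  · rw [Ne, map_eq_bot_iff, ← cyl_empty N, (cyl_injective N).eq_iff]
    exact Set.singleton_ne_empty _
  · rw [hφ, ← map_inf, Ne, map_eq_bot_iff, freeAction_cyl, ← cyl_inter, ← cyl_empty N,
      (cyl_injective N).eq_iff, ← Ne, ← Set.nonempty_iff_ne_empty] at hw
    obtain ⟨_, ⟨_, rfl, rfl⟩, (hw : (w : FinQuot N) * 1 = 1)⟩ := hw
    rw [mul_one] at hw
    exact (QuotientGroup.eq_one_iff w).1 hw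

/-- The trace of an invariant clopen set is invariant under all left translations of the free group,
hence empty or everything. -/
theorem diagConjClass_subset_fixedPointFree (k : ℕ) :
    diagConjClass (fun i => freeAction k (FreeGroup.of i)) ⊆ fixedPointFree k := by
  intro q hq
  rw [mem_fixedPointFree]
  obtain ⟨φ, hφ⟩ := exists_wordMap_conj hq
  intro a ha
  have hfix : ∀ w, wordMap q w a = a := by
    intro w
    induction w using FreeGroup.induction_on with
    | C1 => exact wordMap_one q a
    | of i => rw [wordMap_of, ha i]
    | inv_of i ih => conv_lhs => rw [← ih, wordMap_inv_wordMap]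
    | mul v w hv hw => rw [wordMap_mul, hw, hv]
  have hb : ∀ w, (freeAction k w : ClopAlg k ≃o ClopAlg k) (φ.symm a) = φ.symm a := by
    intro w
    rw [OrderIso.eq_symm_apply, ← hφ, OrderIso.apply_symm_apply, hfix]
  have hcases : φ.symm a = ⊥ ∨ φ.symm a = ⊤ := by
    rcases (trace (φ.symm a)).eq_empty_or_nonempty with he | ⟨v, hv⟩
    · exact Or.inl (trace_injective he)
    · refine Or.inr (trace_injective (Set.eq_univ_of_forall fun w => ?_))
      rw [← hb (w * v⁻¹), mem_trace_freeAction]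
      simpa using hv
  exact hcases.imp (fun h => by simpa using h) fun h => by simpa using h

theorem dense_diagConjClass (k : ℕ) : Dense (((↑) : fixedPointFree k → Fin k → measuredAut k) ⁻¹'
    diagConjClass (fun i => freeAction k (FreeGroup.of i))) := by
  intro h
  rw [mem_closure_iff_nhds]
  intro U hU
  rw [nhds_subtype, Filter.mem_comap] at hU
  obtain ⟨V, hV, hVU⟩ := hU
  obtain ⟨s, hs⟩ := exists_finset_of_mem_nhds_pi hV
  obtain ⟨g, hg, hgs⟩ := exists_diagConjClass_eqOn h.2 s
  exact ⟨⟨g, diagConjClass_subset_fixedPointFree k hg⟩, hVU (hs g hgs), hg⟩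

theorem mem_residual_of_isOpen {P : Set (Fin k → measuredAut k)} (hP : IsOpen P)
    (hsub : diagConjClass (fun i => freeAction k (FreeGroup.of i)) ⊆ P) :
    ((↑) : fixedPointFree k → Fin k → measuredAut k) ⁻¹' P ∈ residual (fixedPointFree k) :=
  residual_of_dense_open (hP.preimage continuous_subtype_val)
    ((dense_diagConjClass k).mono (Set.preimage_mono hsub))

/-! ### Recovering the canonical action from visit sets -/

theorem mem_finset_sup {s : Finset (ClopAlg k)} {x : FreeCompletion k} :
    x ∈ s.sup id ↔ ∃ a ∈ s, x ∈ a := by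
  classical
  induction s using Finset.induction_on with
  | empty =>
    simp only [Finset.sup_empty, Finset.notMem_empty, false_and, exists_false, iff_false]
    exact fun h => h
  | insert a s _ ih =>
    rw [Finset.sup_insert, Finset.exists_mem_insert, ← ih]
    rfl

/-- The set of words whose inverse moves a clopen set to a neighbourhood of the identity. -/
def visitSet (h : Fin k → measuredAut k) (a : ClopAlg k) : Set (FreeGroup (Fin k)) :=
  {w | (1 : FreeCompletion k) ∈ wordMap h w⁻¹ a}

theorem mem_visitSet {h : Fin k → measuredAut k} {a : ClopAlg k} {w : FreeGroup (Fin k)} :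
    w ∈ visitSet h a ↔ (1 : FreeCompletion k) ∈ wordMap h w⁻¹ a := Iff.rfl

theorem visitSet_wordMap (h : Fin k → measuredAut k) (v : FreeGroup (Fin k)) (a : ClopAlg k) :
    visitSet h (wordMap h v a) = {w | v⁻¹ * w ∈ visitSet h a} := by
  ext w
  rw [Set.mem_ofPred_eq, mem_visitSet, mem_visitSet, ← wordMap_mul, mul_inv_rev, inv_inv]

theorem mem_visitSet_finset_sup {h : Fin k → measuredAut k} {s : Finset (ClopAlg k)}
    {w : FreeGroup (Fin k)} : w ∈ visitSet h (s.sup id) ↔ ∃ a ∈ s, w ∈ visitSet h a := by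
  classical
  rw [mem_visitSet, map_finset_sup, Function.comp_id]
  have : s.sup (wordMap h w⁻¹) = (s.image (wordMap h w⁻¹)).sup id := by
    rw [Finset.sup_image, Function.id_comp]
  rw [this, mem_finset_sup, Finset.exists_mem_image]
  rfl

/-- The join of the finite orbit of a is a common fixed point. If it is everything, some member of
the orbit contains 1 and yields a visit; otherwise a is empty. -/
theorem eq_bot_of_visitSet_eq_empty {h : Fin k → measuredAut k} (hh : h ∈ fixedPointFree k)
    {a : ClopAlg k} (ha : (wordOrbit h a).Finite) (hempty : visitSet h a = ∅) : a = ⊥ := by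
  classical
  let s := ha.toFinset.sup id
  have hle : ∀ w, wordMap h w s ≤ s := by
    intro w
    rw [map_finset_sup]
    refine Finset.sup_le fun b hb => ?_
    exact Finset.le_sup (f := id)
      (ha.mem_toFinset.2 (wordMap_mem_wordOrbit h w (ha.mem_toFinset.1 hb)))
  have hfix : ∀ w, wordMap h w s = s := fun w =>
    (hle w).antisymm (by simpa [wordMap_wordMap_inv] using (wordMap h w).monotone (hle w⁻¹))
  rcases mem_fixedPointFree.1 hh s fun i => by rw [← wordMap_of, hfix] with hs | hs
  · refine le_bot_iff.1 (hs ▸ ?_)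
    exact Finset.le_sup (f := id) (ha.mem_toFinset.2 (self_mem_wordOrbit h a))
  · have h1 : (1 : FreeCompletion k) ∈ s := by rw [hs]; exact True.intro
    obtain ⟨b, hb, h1b⟩ := mem_finset_sup.1 h1
    obtain ⟨w, rfl⟩ := ha.mem_toFinset.1 hb
    have : w⁻¹ ∈ visitSet h a := by rw [mem_visitSet, inv_inv]; exact h1b
    rw [hempty] at this
    exact this.elim

/-- Visit sets respect Boolean operations, so an inclusion of visit sets says that `a ⊓ bᶜ` is never
visited. -/
theorem visitSet_subset_visitSet {h : Fin k → measuredAut k} (hh : h ∈ fixedPointFree k)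
    (hfin : ∀ a, (wordOrbit h a).Finite) {a b : ClopAlg k} :
    visitSet h a ⊆ visitSet h b ↔ a ≤ b := by
  refine ⟨fun hab => ?_, fun hab w hw => (wordMap h w⁻¹).monotone hab hw⟩
  rw [← disjoint_compl_right_iff, disjoint_iff]
  refine eq_bot_of_visitSet_eq_empty hh (hfin _) (Set.eq_empty_of_forall_notMem fun w hw => ?_)
  rw [mem_visitSet, map_inf, map_compl'] at hw
  exact hw.2 (hab hw.1)

theorem exists_trace_eq_visitSet {h : Fin k → measuredAut k} {a : ClopAlg k}
    (ha : (wordOrbit h a).Finite) : ∃ b, trace b = visitSet h a := by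
  let _ : MulAction (FreeGroup (Fin k)) (ClopAlg k) :=
    { smul := fun w b => wordMap h w b
      one_smul := wordMap_one h
      mul_smul := wordMap_mul h }
  have : Finite (MulAction.orbit (FreeGroup (Fin k)) a) := ha
  have : Finite (FreeGroup (Fin k) ⧸ MulAction.stabilizer (FreeGroup (Fin k)) a) :=
    Finite.of_equiv _ (MulAction.orbitEquivQuotientStabilizer (FreeGroup (Fin k)) a)
  have : (MulAction.stabilizer (FreeGroup (Fin k)) a).FiniteIndex :=
    Subgroup.finiteIndex_of_finite_quotient
  -- The visit set is stable under left multiplication by the stabilizer of a. Passing to the normal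
  -- core converts this to right multiplication, as wn = (wnw⁻¹)w.
  refine (exists_trace_cyl_eq (N := FiniteIndexNormalSubgroup.ofSubgroup
    (MulAction.stabilizer (FreeGroup (Fin k)) a).normalCore) ?_).imp' (cyl _) fun _ hB => hB
  intro w n hn hw
  have hst : wordMap h (w * n⁻¹ * w⁻¹) a = a := by
    have := inv_mem (hn w)
    rw [mul_inv_rev, mul_inv_rev, inv_inv, ← mul_assoc] at this
    exact this
  have hprod : (w * n)⁻¹ = w⁻¹ * (w * n⁻¹ * w⁻¹) := by group
  rw [mem_visitSet, hprod, wordMap_mul, hst]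
  exact hw

theorem exists_visitSet_eq_subgroup {h : Fin k → measuredAut k} (hh : h ∈ fixedPointFree k)
    (hfin : ∀ a, (wordOrbit h a).Finite) {N : FiniteIndexNormalSubgroup (FreeGroup (Fin k))}
    (hN : h ∈ wanderingSet N) : ∃ c, visitSet h c = (N : Set (FreeGroup (Fin k))) := by
  obtain ⟨a, ha, -, haN⟩ := hN
  obtain ⟨u, hu⟩ : (visitSet h a).Nonempty := by
    rw [Set.nonempty_iff_ne_empty]
    exact fun he => ha (eq_bot_of_visitSet_eq_empty hh (hfin a) he)
  -- The translate of a by u⁻¹ is visited at 1 and, by wandering and normality, only at elements of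
  -- N: two translates of a both containing the point 1 must intersect.
  have hsub : ∀ w, u * w ∈ visitSet h a → w ∈ N := by
    intro w hw
    rw [mem_visitSet] at hu hw
    have hne : wordMap h (u * w⁻¹ * u⁻¹) a ⊓ a ≠ ⊥ := by
      rw [mul_assoc, wordMap_mul, ← mul_inv_rev]
      nth_rewrite 2 [← wordMap_wordMap_inv h u a]
      rw [← map_inf, Ne, map_eq_bot_iff]
      intro he
      have : (1 : FreeCompletion k) ∈ wordMap h (u * w)⁻¹ a ⊓ wordMap h u⁻¹ a := ⟨hw, hu⟩
      rw [he] at this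
      exact this.elim
    have h2 : u⁻¹ * (u * w⁻¹ * u⁻¹) * u⁻¹⁻¹ ∈ N := N.isNormal'.conj_mem _ (haN _ hne) u⁻¹
    have h3 : u⁻¹ * (u * w⁻¹ * u⁻¹) * u⁻¹⁻¹ = w⁻¹ := by group
    rw [h3] at h2
    exact inv_mem_iff.1 h2
  have hfinN : ((fun v => wordMap h (v * u⁻¹) a) '' (N : Set (FreeGroup (Fin k)))).Finite := by
    refine (hfin a).subset ?_
    rintro _ ⟨v, -, rfl⟩
    exact ⟨_, rfl⟩
  -- Joining the N-translates of that set fills its visit set up to all of N; the join is finite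
  -- because the orbit of a is.
  refine ⟨hfinN.toFinset.sup id, ?_⟩
  ext w
  rw [mem_visitSet_finset_sup]
  constructor
  · rintro ⟨b, hb, hw⟩
    obtain ⟨v, hv, rfl⟩ := hfinN.mem_toFinset.1 hb
    change w ∈ visitSet h (wordMap h (v * u⁻¹) a) at hw
    rw [visitSet_wordMap, Set.mem_ofPred_eq, mul_inv_rev, inv_inv, mul_assoc] at hw
    have := mul_mem hv (hsub _ hw)
    rwa [mul_inv_cancel_left] at this
  · intro hw
    refine ⟨_, hfinN.mem_toFinset.2 ⟨w, hw, rfl⟩, ?_⟩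
    change w ∈ visitSet h (wordMap h (w * u⁻¹) a)
    rw [visitSet_wordMap, Set.mem_ofPred_eq]
    simpa using hu

theorem exists_visitSet_eq_trace {h : Fin k → measuredAut k} (hh : h ∈ fixedPointFree k)
    (hfin : ∀ a, (wordOrbit h a).Finite) (hN : ∀ N, h ∈ wanderingSet N) (b : ClopAlg k) :
    ∃ a, visitSet h a = trace b := by
  classical
  obtain ⟨N, hb⟩ := exists_isLevel b
  obtain ⟨B, rfl⟩ := hb.eq_cyl
  obtain ⟨c, hc⟩ := exists_visitSet_eq_subgroup hh hfin (hN N)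
  -- Translating c by coset representatives realizes each coset in `B` as a visit set, and finite
  -- joins realize their union.
  refine ⟨((Set.toFinite B).toFinset.image fun q => wordMap h q.out c).sup id, ?_⟩
  ext w
  rw [mem_visitSet_finset_sup, Finset.exists_mem_image, mem_trace_cyl]
  have hmem : ∀ q : FinQuot N, w ∈ visitSet h (wordMap h q.out c) ↔ q = w := by
    intro q
    rw [visitSet_wordMap, Set.mem_ofPred_eq, hc]
    conv_rhs => rw [← QuotientGroup.out_eq' q, QuotientGroup.eq]
    rfl
  simp only [hmem, Set.Finite.mem_toFinset]
  exact ⟨fun ⟨q, hq, e⟩ => e ▸ hq, fun hw => ⟨_, hw, rfl⟩⟩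

/-- Haar measure transported through `φ` is an invariant finitely additive probability for the
canonical action, so it also counts cosets. -/
theorem haarProb_eq_of_equivariant {h : Fin k → measuredAut k} (φ : ClopAlg k ≃o ClopAlg k)
    (hφ : ∀ w a, φ (wordMap h w a) = (freeAction k w : ClopAlg k ≃o ClopAlg k) (φ a))
    (a : ClopAlg k) :
    haarProb k (φ a : Set (FreeCompletion k)) = haarProb k (a : Set (FreeCompletion k)) := by
  obtain ⟨N, hN⟩ := exists_isLevel (φ a)
  obtain ⟨B, hB⟩ := hN.eq_cyl
  have key := invariant_content_cyl
    (fun b => haarProb k ((φ.symm b : ClopAlg k) : Set (FreeCompletion k)))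
    (by simp) (by rw [map_top]; exact Measure.haarMeasure_self) (by
      intro a b hab
      rw [map_sup, Clopens.coe_sup, measure_union _ (measurableSet_clop _)]
      rw [Set.disjoint_iff_inter_eq_empty]
      have : φ.symm a ⊓ φ.symm b = ⊥ := by rw [← map_inf, disjoint_iff.1 hab, map_bot]
      exact congrArg (fun a : ClopAlg k => (a : Set (FreeCompletion k))) this) (by
      intro w b
      have : φ.symm ((freeAction k w : ClopAlg k ≃o ClopAlg k) b) =
          wordMap h w (φ.symm b) := by
        rw [OrderIso.symm_apply_eq, hφ, OrderIso.apply_symm_apply]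
      change haarProb k ((φ.symm _ : ClopAlg k) : Set (FreeCompletion k)) = _
      rw [this]
      exact (FreeGroup.lift h w).2 _) N B
  rw [← haarProb_cyl, ← hB] at key
  simpa using key.symm

theorem mem_diagConjClass {h : Fin k → measuredAut k} (hh : h ∈ fixedPointFree k)
    (hfin : ∀ a, h ∈ finiteOrbitSet a) (hN : ∀ N, h ∈ wanderingSet N) :
    h ∈ diagConjClass (fun i => freeAction k (FreeGroup.of i)) := by
  -- The conjugacy sends a to the clopen set whose trace is the visit set of a.
  choose f hf using fun a => exists_trace_eq_visitSet (hfin a)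
  let e : ClopAlg k ↪o ClopAlg k := OrderEmbedding.ofMapLEIff f fun a b => by
    rw [← trace_subset_trace, hf, hf, visitSet_subset_visitSet hh hfin]
  have he : Function.Surjective e := fun b => by
    obtain ⟨a, ha⟩ := exists_visitSet_eq_trace hh hfin hN b
    exact ⟨a, trace_injective ((hf a).trans ha)⟩
  let φ : ClopAlg k ≃o ClopAlg k := RelIso.ofSurjective e he
  have htrace : ∀ a, trace (φ a) = visitSet h a := hf
  have hφ : ∀ w a, φ (wordMap h w a) = (freeAction k w : ClopAlg k ≃o ClopAlg k) (φ a) := by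
    intro w a
    apply trace_injective
    ext v
    rw [htrace, visitSet_wordMap, mem_trace_freeAction, htrace]
    rfl
  let Φ : measuredAut k := ⟨φ, haarProb_eq_of_equivariant φ hφ⟩
  refine ⟨Φ⁻¹, fun i => ?_⟩
  rw [inv_inv, mul_assoc, eq_inv_mul_iff_mul_eq]
  apply Subtype.ext
  apply RelIso.ext
  intro a
  change φ ((h i : ClopAlg k ≃o ClopAlg k) a) = _
  rw [← wordMap_of, hφ]
  rfl

/-! ### Genericity -/

theorem isGenericIn_fixedPointFree (k : ℕ) :
    IsGenericIn (freeAction k) (fixedPointFree k) := by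
  refine ⟨diagConjClass_subset_fixedPointFree k, ?_⟩
  have h1 : (⋂ a, ((↑) : fixedPointFree k → Fin k → measuredAut k) ⁻¹' finiteOrbitSet a) ∈
      residual (fixedPointFree k) := countable_iInter_mem.2 fun a =>
    mem_residual_of_isOpen (isOpen_finiteOrbitSet a) (diagConjClass_subset_finiteOrbitSet a)
  have h2 : (⋂ N, ((↑) : fixedPointFree k → Fin k → measuredAut k) ⁻¹' wanderingSet N) ∈
      residual (fixedPointFree k) := countable_iInter_mem.2 fun N =>
    mem_residual_of_isOpen (isOpen_wanderingSet N) (diagConjClass_subset_wanderingSet N)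
  filter_upwards [h1, h2] with h hfin hN
  exact mem_diagConjClass h.2 (fun a => Set.mem_iInter.1 hfin a)
    fun N => Set.mem_iInter.1 hN N

end ProfiniteAction

theorem theorem6 (k : ℕ) :
    IsClosed (ProfiniteAction.fixedPointFree k) ∧
    PolishSpace (ProfiniteAction.fixedPointFree k) ∧
    ProfiniteAction.IsGenericIn (ProfiniteAction.freeAction k)
      (ProfiniteAction.fixedPointFree k) :=
  ⟨ProfiniteAction.isClosed_fixedPointFree k, ProfiniteAction.polishSpace_fixedPointFree k,
    ProfiniteAction.isGenericIn_fixedPointFree k⟩
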